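/- Let $R$ be a commutative Noetherian ring with non-zero identity. A \emph{system of ideals} of $R$ is a non-empty set $\Phi$ of ideals of $R$ such that for all $\mathfrak a_1,\mathfrak a_2\in\Phi$ there is $\mathfrak b\in\Phi$ with $\mathfrak b\subseteq\mathfrak a_1\mathfrak a_2$. For an $R$-module $X$ put $\Gamma_\Phi(X)=\{x\in X\mid \mathfrak a x=0\text{ for some }\mathfrak a\in\Phi\}$, and let $H^i_\Phi$ be the $i$-th right derived functor of $\Gamma_\Phi$. For an ideal $\mathfrak a$ of $R$ and $R$-modules $X,Y$ let $H^i_{\mathfrak a}(X)=\varinjlim_n\operatorname{Ext}^i_R(R/\mathfrak a^n,X)$ and $H^i_{\mathfrak a}(Y,X)=\varinjlim_n\operatorname{Ext}^i_R(Y/\mathfrak a^nY,X)$. For a finitely generated $R$-module $X$ let $\operatorname{grade}(\mathfrak a,X)$ be the supremum of the lengths of the $X$-regular sequences contained in $\mathfrak a$ if $\mathfrak aX\neq X$, and $+\infty$ if $\mathfrak aX=X$; let $\operatorname{grade}(\Phi,X)=\inf\{\operatorname{grade}(\mathfrak a,X)\mid\mathfrak a\in\Phi\}$. Let $\Phi$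 be a system of ideals of $R$, and let $M$, $N$ be finitely generated $R$-modules such that $\operatorname{Supp}_R(N)=V(\mathfrak a)$ for some $\mathfrak a\in\Phi$. If $\operatorname{grade}(\Phi,M)=t$ for a non-negative integer $t$, then there are isomorphisms of $R$-modules $$\operatorname{Hom}_R(N,H^t_\Phi(M))\cong\operatorname{Ext}^t_R(N,M)\cong H^t_{\mathfrak a}(N,M)\cong\operatorname{Hom}_R(N,H^t_{\mathfrak a}(M)).$$ -/

import Mathlib

open CategoryTheory

universe u

noncomputable section

/-- A system of ideals of `R`: a non-empty set of ideals such that any product of two members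
contains a member. -/
structure IdealSystem (R : Type u) [CommRing R] where
  /-- The set of ideals. -/
  carrier : Set (Ideal R)
  nonempty : carrier.Nonempty
  exists_le_mul : ∀ I ∈ carrier, ∀ J ∈ carrier, ∃ K ∈ carrier, K ≤ I * J

namespace IdealSystem

variable {R : Type u} [CommRing R] (Φ : IdealSystem R)

/-- The submodule `Γ_Φ(M) = {x ∈ M | I x = 0 for some I ∈ Φ}` of `M`. -/
def gamma (M : Type u) [AddCommGroup M] [Module R M] : Submodule R M where
  carrier := {x | ∃ I ∈ Φ.carrier, ∀ r ∈ I, r • x = 0}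
  zero_mem' := by
    obtain ⟨I, hI⟩ := Φ.nonempty
    exact ⟨I, hI, fun r _ => smul_zero r⟩
  add_mem' := by
    rintro x y ⟨I, hI, hx⟩ ⟨J, hJ, hy⟩
    obtain ⟨K, hK, hle⟩ := Φ.exists_le_mul I hI J hJ
    refine ⟨K, hK, fun r hr => ?_⟩
    have h : r ∈ I ⊓ J := Ideal.mul_le_inf (hle hr)
    rw [smul_add, hx r h.1, hy r h.2, add_zero]
  smul_mem' := by
    rintro c x ⟨I, hI, hx⟩
    exact ⟨I, hI, fun r hr => by rw [smul_comm, hx r hr, smul_zero]⟩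

theorem map_mem_gamma {M N : Type u} [AddCommGroup M] [Module R M] [AddCommGroup N] [Module R N]
    (f : M →ₗ[R] N) : ∀ x ∈ Φ.gamma M, f x ∈ Φ.gamma N := by
  rintro x ⟨I, hI, hx⟩
  exact ⟨I, hI, fun r hr => by rw [← map_smul, hx r hr, map_zero]⟩

/-- The functor `Γ_Φ` on `R`-modules; it restricts a linear map to the torsion submodules. -/
def gammaFunctor : ModuleCat.{u} R ⥤ ModuleCat.{u} R where
  obj M := ModuleCat.of R (Φ.gamma M)
  map f := ModuleCat.ofHom (f.hom.restrict (Φ.map_mem_gamma f.hom))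

instance gammaFunctor_additive : Φ.gammaFunctor.Additive where

/-- The `i`-th general local cohomology functor `H^i_Φ`: the `i`-th right derived functor
of `Γ_Φ`. -/
def generalLocalCohomology (i : ℕ) : ModuleCat.{u} R ⥤ ModuleCat.{u} R :=
  Φ.gammaFunctor.rightDerived i

end IdealSystem

/-- The grade of an ideal `I` on a (finitely generated) module `M`: it is `∞` if `I M = M`, and
otherwise the supremum of the lengths of the `M`-regular sequences in `I`. -/
def idealGrade {R : Type u} [CommRing R] (I : Ideal R) (M : Type u) [AddCommGroup M]
    [Module R M] : ℕ∞ :=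
  open Classical in
  if I • (⊤ : Submodule R M) = ⊤ then ⊤
  else ⨆ (rs : List R) (_ : RingTheory.Sequence.IsRegular M rs ∧ ∀ r ∈ rs, r ∈ I),
    (rs.length : ℕ∞)

/-- `grade(Φ, M) = inf {grade(I, M) | I ∈ Φ}`. -/
def IdealSystem.grade {R : Type u} [CommRing R] (Φ : IdealSystem R) (M : Type u)
    [AddCommGroup M] [Module R M] : ℕ∞ :=
  ⨅ I ∈ Φ.carrier, idealGrade I M

/-- The inverse system `n ↦ N / I ^ n N`, with the canonical surjections. -/
def quotientPowersDiagram {R : Type u} [CommRing R] (I : Ideal R) (N : Type u) [AddCommGroup N]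
    [Module R N] : ℕᵒᵖ ⥤ ModuleCat.{u} R where
  obj n := ModuleCat.of R (N ⧸ (I ^ n.unop • ⊤ : Submodule R N))
  map w := ModuleCat.ofHom (Submodule.mapQ _ _ LinearMap.id
    (Submodule.smul_mono_left (Ideal.pow_le_pow_right w.unop.le)))
  map_id n := by
    ext x
    simp
  map_comp v w := by
    ext x
    simp

/-- The `i`-th generalized local cohomology functor `H^i_I(N, -)`: the direct limit over `n`
of `Ext^i(N / I ^ n N, -)`. -/
def generalizedLocalCohomology {R : Type u} [CommRing R] (I : Ideal R) (i : ℕ) (N : Type u)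
    [AddCommGroup N] [Module R N] : ModuleCat.{u} R ⥤ ModuleCat.{u} R :=
  Limits.colimit ((quotientPowersDiagram I N).op ⋙ Ext R (ModuleCat.{u} R) i)

end

/-!
Let `I` be an injective resolution of `M`. A module `X` annihilated by a member of `Φ` satisfies
`Hom(X, I) = Hom(X, Γ_Φ(I))`, so that `Ext^t(X, M)` is the cohomology of `Hom(X, Γ_Φ(I))`. The
modules of `Γ_Φ(I)` are injective by Artin–Rees, and the vanishing of `Ext^i(R/b, M)` for `i < t`
and `b ∈ Φ` makes this complex exact, hence split, below degree `t`. Therefore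
`Ext^t(X, M) ≅ Hom(X, H^t_Φ(M))`, naturally in `X`. The case `X = N` is the first isomorphism; the
cases `X = R/a^m` give `H^t_a(M) ≅ Γ_a(H^t_Φ(M))` in the limit, and `Hom(N, -)` does not see the
difference between a module and its `a`-torsion. The direct system defining `H^t_a(N, M)` is
eventually constant because a power of `a` annihilates `N`.
-/

noncomputable section

open Limits

universe v w

section Splitting

variable {C : Type*} [Category* C] [Abelian C] {K : CochainComplex C ℕ}

theorem mono_fromOpcycles_of_exactAt {i : ℕ} (h : K.ExactAt i) :
    Mono (K.fromOpcycles i (i + 1)) :=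
  Preadditive.mono_of_isZero_kernel' _ (K.homologyIsKernel i (i + 1) (by simp)) h.isZero_homology

theorem shortExact_fromOpcycles_pOpcycles {i : ℕ} (h : K.ExactAt i) :
    (ShortComplex.mk (K.fromOpcycles i (i + 1)) (K.pOpcycles (i + 1)) (by
      simp [← cancel_epi (K.pOpcycles i)])).ShortExact where
  exact := by
    let S := ShortComplex.mk (K.d i (i + 1)) (K.pOpcycles (i + 1)) (K.d_pOpcycles _ _)
    let S' := ShortComplex.mk (K.fromOpcycles i (i + 1)) (K.pOpcycles (i + 1)) (by
      simp [← cancel_epi (K.pOpcycles i)])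
    let φ : S ⟶ S' := { τ₁ := K.pOpcycles i, τ₂ := 𝟙 _, τ₃ := 𝟙 _ }
    have : Epi φ.τ₁ := inferInstanceAs (Epi (K.pOpcycles i))
    have : IsIso φ.τ₂ := inferInstanceAs (IsIso (𝟙 _))
    have : Mono φ.τ₃ := inferInstanceAs (Mono (𝟙 _))
    exact (ShortComplex.exact_iff_of_epi_of_isIso_of_mono φ).1
      (ShortComplex.exact_of_g_is_cokernel _ (K.opcyclesIsCokernel i (i + 1) (by simp)))
  mono_f := mono_fromOpcycles_of_exactAt h
  epi_g := inferInstanceAs (Epi (K.pOpcycles _))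

variable (K) in
theorem section_pOpcycles_comp_d (n : ℕ) [IsSplitEpi (K.pOpcycles n)] :
    section_ (K.pOpcycles n) ≫ K.d n (n + 1) = K.fromOpcycles n (n + 1) := by
  rw [← K.p_fromOpcycles n (n + 1), IsSplitEpi.id_assoc]

variable [∀ i, Injective (K.X i)] {n : ℕ}

theorem injective_opcycles_and_isSplitEpi_pOpcycles (hK : ∀ i < n, K.ExactAt i) :
    Injective (K.opcycles n) ∧ IsSplitEpi (K.pOpcycles n) := by
  induction n with
  | zero =>
    have := K.isIso_pOpcycles 0 0 (by simp) (by simp)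
    exact ⟨Injective.of_iso (asIso (K.pOpcycles 0)) inferInstance, inferInstance⟩
  | succ n ih =>
    have := (ih fun i hi => hK i (by omega)).1
    have σ := (shortExact_fromOpcycles_pOpcycles (hK n n.lt_succ_self)).splittingOfInjective
    exact ⟨Retract.injective ⟨σ.s, _, σ.s_g⟩, ⟨⟨⟨σ.s, σ.s_g⟩⟩⟩⟩

theorem isSplitEpi_homologyπ (hK : ∀ i < n, K.ExactAt i) : IsSplitEpi (K.homologyπ n) := by
  have := (injective_opcycles_and_isSplitEpi_pOpcycles hK).2
  refine ⟨⟨⟨K.liftCycles (K.homologyι n ≫ section_ (K.pOpcycles n)) (n + 1) (by simp) ?_, ?_⟩⟩⟩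
  · rw [Category.assoc, section_pOpcycles_comp_d, K.homologyι_comp_fromOpcycles]
  · simp [← cancel_mono (K.homologyι n)]

theorem exists_comp_toCycles_eq (hK : ∀ i < n, K.ExactAt i) {X : C} (z : X ⟶ K.cycles n)
    (hz : z ≫ K.homologyπ n = 0) :
    ∃ g : X ⟶ K.X ((ComplexShape.up ℕ).prev n), g ≫ K.toCycles _ n = z := by
  replace hz : (z ≫ K.iCycles n) ≫ K.pOpcycles n = 0 := by
    rw [Category.assoc, ← K.homology_π_ι, reassoc_of% hz, zero_comp]
  cases n with
  | zero =>
    have := K.isIso_pOpcycles 0 0 (by simp) (by simp)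
    exact ⟨0, by rw [← cancel_mono (K.iCycles 0), ← cancel_mono (K.pOpcycles 0), hz]; simp⟩
  | succ n =>
    have := (injective_opcycles_and_isSplitEpi_pOpcycles (K := K) (n := n)
      fun i hi => hK i (by omega)).2
    have hS := shortExact_fromOpcycles_pOpcycles (hK n n.lt_succ_self)
    have := hS.mono_f
    obtain ⟨g, hg⟩ : ∃ g, g ≫ K.fromOpcycles n (n + 1) = z ≫ K.iCycles (n + 1) :=
      ⟨hS.exact.lift _ hz, hS.exact.lift_f _ hz⟩
    rw [CochainComplex.prev_nat_succ]
    exact ⟨g ≫ section_ (K.pOpcycles n), by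
      simp [← cancel_mono (K.iCycles _), section_pOpcycles_comp_d, hg]⟩

end Splitting

section Cycles

variable {R : Type*} [Ring R] {ι : Type*} {c : ComplexShape ι}
  (K : HomologicalComplex (ModuleCat.{v} R) c)

theorem homologyπ_surjective (n : ι) : Function.Surjective (K.homologyπ n) :=
  (ModuleCat.epi_iff_surjective _).1 inferInstance

theorem iCycles_injective (n : ι) : Function.Injective (K.iCycles n) :=
  (ModuleCat.mono_iff_injective _).1 inferInstance

theorem exists_iCycles_eq {n : ι} {x : K.X n} (hx : K.d n (c.next n) x = 0) :
    ∃ z : K.cycles n, K.iCycles n z = x :=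
  ⟨(K.sc n).moduleCatCyclesIso.inv (⟨x, hx⟩ : LinearMap.ker (K.sc n).g.hom),
    ConcreteCategory.congr_hom (K.sc n).moduleCatCyclesIso_inv_iCycles _⟩

theorem homologyπ_eq_zero_iff {n : ι} (z : K.cycles n) :
    K.homologyπ n z = 0 ↔ ∃ y : K.X (c.prev n), K.d (c.prev n) n y = K.iCycles n z := by
  have hexact := (ShortComplex.ShortExact.moduleCat_exact_iff_function_exact _).1
    (ShortComplex.exact_of_g_is_cokernel (.mk _ _ (K.toCycles_comp_homologyπ (c.prev n) n))
      (K.homologyIsCokernel _ n rfl))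
  refine (hexact z).trans (exists_congr fun y => ?_)
  rw [← (iCycles_injective K n).eq_iff]
  exact iff_of_eq (congrArg (· = _) (ConcreteCategory.congr_hom (K.toCycles_i _ n) y))

end Cycles

/-- The isomorphism between the targets of two surjections with the same kernel. -/
def equivOfSurjectiveOfKer {R K A B : Type*} [Ring R]
    [AddCommGroup K] [Module R K] [AddCommGroup A] [Module R A] [AddCommGroup B] [Module R B]
    (f : K →ₗ[R] A) (g : K →ₗ[R] B) (hf : Function.Surjective f) (hg : Function.Surjective g)
    (h : ∀ x, f x = 0 ↔ g x = 0) : A ≃ₗ[R] B :=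
  (f.quotKerEquivOfSurjective hf).symm ≪≫ₗ
    Submodule.quotEquivOfEq _ _ (by ext x; exact h x) ≪≫ₗ g.quotKerEquivOfSurjective hg

theorem equivOfSurjectiveOfKer_apply {R K A B : Type*} [Ring R]
    [AddCommGroup K] [Module R K] [AddCommGroup A] [Module R A] [AddCommGroup B] [Module R B]
    (f : K →ₗ[R] A) (g : K →ₗ[R] B) (hf : Function.Surjective f) (hg : Function.Surjective g)
    (h : ∀ x, f x = 0 ↔ g x = 0) (x : K) :
    equivOfSurjectiveOfKer f g hf hg h (f x) = g x := by
  have : (f.quotKerEquivOfSurjective hf).symm (f x) = Submodule.Quotient.mk x := by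
    rw [LinearEquiv.symm_apply_eq]; rfl
  simp only [equivOfSurjectiveOfKer, LinearEquiv.trans_apply, this]
  rfl

section ExtComparison

variable {R : Type*} [CommRing R] {C : Type*} [Category.{v} C] [Abelian C] [Linear R C]

-- For `n = 0` the differential on the right is `d 0 0 = 0`, as `prev 0 = 0`.
open CochainComplex HomComplex in
theorem extMk_projective_eq_zero_iff [HasExt.{w} C] {X Y : C}
    (P : ProjectiveResolution X) {n : ℕ} (f : P.complex.X n ⟶ Y) (m : ℕ) (hm : n + 1 = m)
    (hf : P.complex.d m n ≫ f = 0) :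
    P.extMk f m hm hf = 0 ↔ ∃ g : P.complex.X ((ComplexShape.up ℕ).prev n) ⟶ Y,
      P.complex.d n ((ComplexShape.up ℕ).prev n) ≫ g = f := by
  cases n with
  | succ n =>
    rw [CochainComplex.prev_nat_succ]
    exact P.extMk_eq_zero_iff f m hm hf n rfl
  | zero =>
    refine ⟨fun h => ⟨0, ?_⟩, ?_⟩
    · replace h := congrArg P.extEquivCohomologyClass h
      rw [P.extEquivCohomologyClass_extMk, P.extEquivCohomologyClass_zero,
        CohomologyClass.mk_eq_zero_iff,
        Cocycle.toSingleMk_mem_coboundaries_iff _ _ _ _ _ 1 (by simp)] at h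
      obtain ⟨g, hg⟩ := h
      rw [(P.cochainComplex.isZero_of_isStrictlyLE 0 1).eq_of_src g 0, comp_zero] at hg
      rw [← cancel_epi (P.cochainComplexXIso (-(0 : ℕ)) 0 rfl).hom, ← hg]
      simp
    · rintro ⟨g, rfl⟩
      simp

/-- The morphism of complexes `Hom(Q, Y) ⟶ Hom(P, Y)` induced by `P ⟶ Q`. -/
def linearYonedaMap (R : Type*) [CommRing R] [Linear R C]
    {P Q : ChainComplex C ℕ} (φ : P ⟶ Q) (Y : C) :
    Q.linearYonedaObj R Y ⟶ P.linearYonedaObj R Y :=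
  (HomologicalComplex.unopFunctor _ _).map
    ((((linearYoneda R C).obj Y).rightOp.mapHomologicalComplex _).map φ).op

theorem isoExt_naturality [EnoughProjectives C] {X X' : C} (f : X ⟶ X') (P : ProjectiveResolution X)
    (Q : ProjectiveResolution X') (φ : ProjectiveResolution.Hom P Q f) (n : ℕ) (Y : C) :
    ((Ext R C n).map f.op).app Y ≫ (P.isoExt (R := R) n Y).hom =
      (Q.isoExt (R := R) n Y).hom ≫
        HomologicalComplex.homologyMap (linearYonedaMap R φ.hom Y) n := by
  have derived_square : ((Ext R C n).map f.op).app Y ≫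
      (P.isoLeftDerivedObj ((linearYoneda R C).obj Y).rightOp n).inv.unop =
      (Q.isoLeftDerivedObj ((linearYoneda R C).obj Y).rightOp n).inv.unop ≫
        (HomologicalComplex.homologyMap ((HomologicalComplex.opFunctor _ _).map
          (linearYonedaMap R φ.hom Y).op) n).unop :=
    congrArg Quiver.Hom.unop (ProjectiveResolution.isoLeftDerivedObj_inv_naturality f P Q φ.hom
      (by simpa using φ.hom_f_zero_comp_π_f_zero) ((linearYoneda R C).obj Y).rightOp n)
  have homologyOp_square : (HomologicalComplex.homologyMap ((HomologicalComplex.opFunctor _ _).map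
        (linearYonedaMap R φ.hom Y).op) n).unop ≫
      ((P.complex.linearYonedaObj R Y).homologyOp n).inv.unop =
      ((Q.complex.linearYonedaObj R Y).homologyOp n).inv.unop ≫
        HomologicalComplex.homologyMap (linearYonedaMap R φ.hom Y) n :=
    Quiver.Hom.op_inj (CommSq.mk (HomologicalComplex.homologyOp_hom_naturality
      (linearYonedaMap R φ.hom Y) n).symm).horiz_inv.w
  exact (Category.assoc _ _ _).symm.trans ((congrArg (· ≫ _) derived_square).trans
    ((Category.assoc _ _ _).trans
      ((congrArg (_ ≫ ·) homologyOp_square).trans (Category.assoc _ _ _).symm)))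

variable {X : C} (P : ProjectiveResolution X) (Y : C) (n : ℕ)

/-- A cocycle of degree `n` of the complex `Hom(P, Y)`, as a morphism `P_n ⟶ Y`. -/
def cocycleHom : (P.complex.linearYonedaObj R Y).cycles n →ₗ[R] (P.complex.X n ⟶ Y) :=
  ((P.complex.linearYonedaObj R Y).iCycles n).hom

variable {Y n}

theorem d_comp_cocycleHom (z : (P.complex.linearYonedaObj R Y).cycles n) :
    P.complex.d (n + 1) n ≫ cocycleHom P Y n z = 0 :=
  ConcreteCategory.congr_hom ((P.complex.linearYonedaObj R Y).iCycles_d n (n + 1)) z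

theorem exists_cocycleHom_eq {f : P.complex.X n ⟶ Y} (hf : P.complex.d (n + 1) n ≫ f = 0) :
    ∃ z : (P.complex.linearYonedaObj R Y).cycles n, cocycleHom P Y n z = f :=
  exists_iCycles_eq _ (by rwa [CochainComplex.next])

variable (Y n) [HasExt.{w} C]

/-- The linear map sending a cocycle to its class in `Ext`. -/
def cocycleClass : (P.complex.linearYonedaObj R Y).cycles n →ₗ[R] Abelian.Ext X Y n where
  toFun z := P.extMk (cocycleHom P Y n z) (n + 1) rfl (d_comp_cocycleHom P z)
  map_add' z z' := by
    simp only [map_add, P.add_extMk]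
  map_smul' r z := by
    simp only [map_smul, RingHom.id_apply, Abelian.Ext.smul_eq_comp_mk₀, P.extMk_comp_mk₀,
      Linear.comp_smul, Category.comp_id]

theorem cocycleClass_apply (z : (P.complex.linearYonedaObj R Y).cycles n) :
    cocycleClass P Y n z =
      P.extMk (cocycleHom P Y n z) (n + 1) rfl (d_comp_cocycleHom P z) :=
  rfl

theorem cocycleClass_surjective : Function.Surjective (cocycleClass (R := R) P Y n) := by
  intro e
  obtain ⟨f, hf, rfl⟩ := P.extMk_surjective e (n + 1) rfl
  obtain ⟨z, rfl⟩ := exists_cocycleHom_eq (R := R) P hf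
  exact ⟨z, rfl⟩

theorem homologyπ_eq_zero_iff_cocycleClass_eq_zero (z : (P.complex.linearYonedaObj R Y).cycles n) :
    (P.complex.linearYonedaObj R Y).homologyπ n z = 0 ↔ cocycleClass P Y n z = 0 :=
  (homologyπ_eq_zero_iff _ z).trans
    (extMk_projective_eq_zero_iff P _ (n + 1) rfl (d_comp_cocycleHom P z)).symm

/-- The cohomology of `Hom(P, Y)` in degree `n` is `Ext` in the sense of `Abelian.Ext`. -/
def homologyEquivExt : (P.complex.linearYonedaObj R Y).homology n ≃ₗ[R] Abelian.Ext X Y n :=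
  equivOfSurjectiveOfKer _ _ (homologyπ_surjective _ n) (cocycleClass_surjective P Y n)
    (homologyπ_eq_zero_iff_cocycleClass_eq_zero P Y n)

theorem homologyEquivExt_homologyπ (z : (P.complex.linearYonedaObj R Y).cycles n) :
    homologyEquivExt P Y n ((P.complex.linearYonedaObj R Y).homologyπ n z) =
      cocycleClass P Y n z :=
  equivOfSurjectiveOfKer_apply ..

theorem homologyEquivExt_naturality {P} {X' : C} {f : X ⟶ X'} {Q : ProjectiveResolution X'}
    (φ : ProjectiveResolution.Hom P Q f) (e : (Q.complex.linearYonedaObj R Y).homology n) :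
    homologyEquivExt P Y n (HomologicalComplex.homologyMap (linearYonedaMap R φ.hom Y) n e) =
      (Abelian.Ext.mk₀ f).comp (homologyEquivExt Q Y n e) (zero_add _) := by
  obtain ⟨z, rfl⟩ := homologyπ_surjective _ n e
  have hz : cocycleHom P Y n (HomologicalComplex.cyclesMap (linearYonedaMap R φ.hom Y) n z) =
      φ.hom.f n ≫ cocycleHom Q Y n z :=
    ConcreteCategory.congr_hom
      (HomologicalComplex.cyclesMap_i (linearYonedaMap R φ.hom Y) n) z
  have hπ := ConcreteCategory.congr_hom
    (HomologicalComplex.homologyπ_naturality (linearYonedaMap R φ.hom Y) n) z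
  rw [ConcreteCategory.comp_apply, ConcreteCategory.comp_apply] at hπ
  rw [hπ, homologyEquivExt_homologyπ, homologyEquivExt_homologyπ]
  simp only [cocycleClass_apply, hz, ProjectiveResolution.mk₀_comp_extMk _ _ _ _ φ]

variable [EnoughProjectives C]

variable (R X)

/-- The identification of the derived functor `Ext` of `Hom(-, Y)` with `Abelian.Ext`. -/
def extEquivAbelianExt :
    ((Ext R C n).obj (Opposite.op X)).obj Y ≃ₗ[R] Abelian.Ext X Y n :=
  ((projectiveResolution X).isoExt n Y).toLinearEquiv ≪≫ₗ
    homologyEquivExt (projectiveResolution X) Y n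

variable {R X}

theorem extEquivAbelianExt_naturality {X X' : C} (f : X ⟶ X')
    (e : ((Ext R C n).obj (Opposite.op X')).obj Y) :
    extEquivAbelianExt R X Y n (((Ext R C n).map f.op).app Y e) =
      (Abelian.Ext.mk₀ f).comp (extEquivAbelianExt R X' Y n e) (zero_add _) := by
  let φ : ProjectiveResolution.Hom (projectiveResolution X) (projectiveResolution X') f :=
    { hom := ProjectiveResolution.lift f _ _
      hom_f_zero_comp_π_f_zero := by simpa using ProjectiveResolution.lift_commutes_zero f _ _ }
  exact (congrArg _ (ConcreteCategory.congr_hom (isoExt_naturality f _ _ φ n Y) e)).trans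
    (homologyEquivExt_naturality Y n φ _)

end ExtComparison

section InjectiveExt

variable {C : Type*} [Category* C] [Abelian C] [HasExt.{w} C]

open CochainComplex HomComplex in
theorem extMk_injective_eq_zero_iff {X Y : C} (I : InjectiveResolution Y) {n : ℕ}
    (f : X ⟶ I.cocomplex.X n) (m : ℕ) (hm : n + 1 = m) (hf : f ≫ I.cocomplex.d n m = 0) :
    I.extMk f m hm hf = 0 ↔ ∃ g : X ⟶ I.cocomplex.X ((ComplexShape.up ℕ).prev n),
      g ≫ I.cocomplex.d ((ComplexShape.up ℕ).prev n) n = f := by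
  cases n with
  | succ n =>
    rw [CochainComplex.prev_nat_succ]
    exact I.extMk_eq_zero_iff f m hm hf n rfl
  | zero =>
    refine ⟨fun h => ⟨0, ?_⟩, ?_⟩
    · replace h := congrArg I.extEquivCohomologyClass h
      rw [I.extEquivCohomologyClass_extMk, I.extEquivCohomologyClass_zero,
        CohomologyClass.mk_eq_zero_iff,
        Cocycle.fromSingleMk_mem_coboundaries_iff _ _ _ _ _ (-1) (by simp)] at h
      obtain ⟨g, hg⟩ := h
      rw [(I.cochainComplex.isZero_of_isStrictlyGE 0 (-1)).eq_of_tgt g 0, zero_comp] at hg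
      rw [← cancel_mono (I.cochainComplexXIso (0 : ℕ) 0 rfl).inv, ← hg]
      simp
    · rintro ⟨g, rfl⟩
      simp

variable {R : Type*} [CommRing R] [Linear R C] {X Y : C} {n : ℕ}

theorem mk₀_smul_id_comp (r : R) (e : Abelian.Ext X Y n) :
    (Abelian.Ext.mk₀ (r • 𝟙 X)).comp e (zero_add n) = r • e := by
  rw [Abelian.Ext.mk₀_smul, Abelian.Ext.smul_comp, Abelian.Ext.mk₀_id_comp]

theorem subsingleton_ext_of_isCoprime {r s : R} (h : IsCoprime r s) (hX : r • 𝟙 X = 0)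
    (hY : s • 𝟙 Y = 0) (n : ℕ) : Subsingleton (Abelian.Ext X Y n) := by
  refine subsingleton_of_forall_eq 0 fun e => ?_
  have hr : r • e = 0 := by rw [← mk₀_smul_id_comp, hX, Abelian.Ext.mk₀_zero, Abelian.Ext.zero_comp]
  have hs : s • e = 0 := by
    rw [Abelian.Ext.smul_eq_comp_mk₀, hY, Abelian.Ext.mk₀_zero, Abelian.Ext.comp_zero]
  obtain ⟨a, b, hab⟩ := h
  rw [← one_smul R e, ← hab, add_smul, mul_smul, mul_smul, hr, hs, smul_zero, smul_zero, add_zero]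

end InjectiveExt

theorem exists_extension_of_forall_mem_eq_zero {R : Type u} [Ring R] {P E : Type u}
    [AddCommGroup P] [Module R P] [AddCommGroup E] [Module R E] [Module.Injective R E]
    {J c : Submodule R P} (g : J →ₗ[R] E) (hg : ∀ x : J, (x : P) ∈ c → g x = 0) :
    ∃ h : P →ₗ[R] E, (∀ x : J, h x = g x) ∧ ∀ x ∈ c, h x = 0 := by
  let g' : P →ₗ.[R] E := ⟨J, g⟩
  let z : P →ₗ.[R] E := ⟨c, 0⟩
  have hagree : ∀ (x : g'.domain) (y : z.domain), (x : P) = y → g' x = z y := fun x y hxy =>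
    hg x (hxy ▸ y.2)
  obtain ⟨h, hh⟩ := Module.Injective.out (g'.sup z hagree).domain.subtype
    (Submodule.subtype_injective _) (g'.sup z hagree).toFun
  refine ⟨h, fun x => ?_, fun x hx => ?_⟩
  · exact (hh ⟨x, le_sup_left (a := J) x.2⟩).trans ((g'.left_le_sup z hagree).2 rfl).symm
  · exact (hh ⟨x, le_sup_right (b := c) hx⟩).trans
      ((g'.right_le_sup z hagree).2 (x := ⟨x, hx⟩) rfl).symm

theorem exists_pow_smul_top_inf_le_smul {R M : Type*} [CommRing R] [IsNoetherianRing R]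
    [AddCommGroup M] [Module R M] [Module.Finite R M] (I : Ideal R) (N : Submodule R M) :
    ∃ k, I ^ k • ⊤ ⊓ N ≤ I • N := by
  obtain ⟨k, hk⟩ := I.exists_pow_inf_eq_pow_smul N
  refine ⟨k + 1, ?_⟩
  rw [hk (k + 1) k.le_succ, Nat.add_sub_cancel_left, pow_one]
  exact Submodule.smul_mono le_rfl inf_le_right

namespace IdealSystem

variable {R : Type u} [CommRing R] {Φ : IdealSystem R}

theorem exists_le_pow {I : Ideal R} (hI : I ∈ Φ.carrier) (n : ℕ) :
    ∃ K ∈ Φ.carrier, K ≤ I ^ n := by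
  induction n with
  | zero => exact ⟨I, hI, by simp⟩
  | succ n ih =>
    obtain ⟨J, hJ, hle⟩ := ih
    obtain ⟨K, hK, h⟩ := Φ.exists_le_mul J hJ I hI
    exact ⟨K, hK, h.trans (pow_succ I n ▸ Ideal.mul_mono_left hle)⟩

theorem exists_le_annihilator_of_fg {M : Type u} [AddCommGroup M] [Module R M]
    {N : Submodule R M} (hN : N.FG) (h : N ≤ Φ.gamma M) :
    ∃ I ∈ Φ.carrier, I ≤ N.annihilator := by
  induction N, hN using Submodule.fg_induction with
  | singleton x =>
    obtain ⟨I, hI, hx⟩ := h (Submodule.mem_span_singleton_self x)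
    exact ⟨I, hI, fun r hr => Submodule.mem_annihilator_span_singleton x r |>.2 (hx r hr)⟩
  | sup N₁ N₂ _ _ h₁ h₂ =>
    obtain ⟨I, hI, hI₁⟩ := h₁ (le_sup_left.trans h)
    obtain ⟨J, hJ, hJ₂⟩ := h₂ (le_sup_right.trans h)
    obtain ⟨K, hK, hKIJ⟩ := Φ.exists_le_mul I hI J hJ
    refine ⟨K, hK, hKIJ.trans ?_⟩
    rw [Submodule.annihilator_sup]
    exact Ideal.mul_le_inf.trans (inf_le_inf hI₁ hJ₂)

theorem injective_gamma [IsNoetherianRing R] (M : Type u) [AddCommGroup M] [Module R M]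
    [Module.Injective R M] : Module.Injective R (Φ.gamma M) := by
  refine Module.Baer.injective fun J g => ?_
  obtain ⟨b, hb, hbg⟩ := exists_le_annihilator_of_fg (Φ := Φ)
    (N := LinearMap.range ((Φ.gamma M).subtype ∘ₗ g)) Submodule.FG.of_finite
    (by rintro _ ⟨x, rfl⟩; exact (g x).2)
  obtain ⟨k, hk⟩ := exists_pow_smul_top_inf_le_smul (M := R) b J
  have hbJ : b • J ≤ (LinearMap.ker g).map J.subtype := by
    refine Submodule.smul_le.2 fun r hr z hz => ⟨r • ⟨z, hz⟩, Subtype.ext ?_, rfl⟩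
    rw [map_smul]
    exact Submodule.mem_annihilator.1 (hbg hr) _ ⟨⟨z, hz⟩, rfl⟩
  -- By Artin–Rees `g` extends to a map killing a power of `b`, which hence lands in `Γ_Φ`.
  obtain ⟨h, hhg, hh0⟩ := exists_extension_of_forall_mem_eq_zero (c := b ^ k)
    ((Φ.gamma M).subtype ∘ₗ g) fun x hx => by
      obtain ⟨y, hy, hyx⟩ := hbJ (hk ⟨by simpa using hx, x.2⟩)
      obtain rfl : y = x := Subtype.ext hyx
      simpa using hy
  refine ⟨h.codRestrict _ fun x => ?_, fun x hx => Subtype.ext (hhg ⟨x, hx⟩)⟩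
  obtain ⟨d, hd, hdb⟩ := exists_le_pow hb k
  exact ⟨d, hd, fun r hr => (h.map_smul r x).symm.trans (hh0 _ (Ideal.mul_mem_right x _ (hdb hr)))⟩

section GammaComplex

variable {R : Type u} [CommRing R] (Φ : IdealSystem R)

/-- The modules annihilated by a member of `Φ`. -/
def Annihilates (X : Type u) [AddCommGroup X] [Module R X] : Prop :=
  ∃ I ∈ Φ.carrier, I ≤ Module.annihilator R X

variable {Φ} {X X' M : ModuleCat.{u} R}

theorem annihilates_quotient {b : Ideal R} (hb : b ∈ Φ.carrier) : Φ.Annihilates (R ⧸ b) :=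
  ⟨b, hb, Ideal.annihilator_quotient.ge⟩

theorem Annihilates.map_mem_gamma {X Y : Type u} [AddCommGroup X] [Module R X] [AddCommGroup Y]
    [Module R Y] (hX : Φ.Annihilates X) (f : X →ₗ[R] Y) (x : X) : f x ∈ Φ.gamma Y := by
  obtain ⟨I, hI, hIX⟩ := hX
  exact ⟨I, hI, fun r hr => by rw [← map_smul, Module.mem_annihilator.1 (hIX hr), map_zero]⟩

variable (Φ) (I : InjectiveResolution M)

/-- The complex `Γ_Φ(I)` for an injective resolution `I`. -/
abbrev gammaComplex : CochainComplex (ModuleCat.{u} R) ℕ :=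
  (Φ.gammaFunctor.mapHomologicalComplex _).obj I.cocomplex

instance injective_gammaComplex_X [IsNoetherianRing R] (i : ℕ) :
    Injective ((Φ.gammaComplex I).X i) := by
  have := Module.injective_module_of_injective_object R (I.cocomplex.X i) (inj := I.injective i)
  have : Module.Injective R (Φ.gamma (I.cocomplex.X i)) := injective_gamma _
  exact Module.injective_object_of_injective_module R (Φ.gamma (I.cocomplex.X i))

/-- The inclusion of `Γ_Φ(I)` in the injective resolution `I`. -/
def gammaComplexι : Φ.gammaComplex I ⟶ I.cocomplex where
  f i := ModuleCat.ofHom (Φ.gamma (I.cocomplex.X i)).subtype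

instance mono_gammaComplexι_f (i : ℕ) : Mono ((Φ.gammaComplexι I).f i) :=
  (ModuleCat.mono_iff_injective _).2 (Submodule.subtype_injective _)

variable {Φ} in
theorem Annihilates.exists_comp_gammaComplexι_f_eq (hX : Φ.Annihilates X) {i : ℕ}
    (f : X ⟶ I.cocomplex.X i) :
    ∃ g : X ⟶ (Φ.gammaComplex I).X i, g ≫ (Φ.gammaComplexι I).f i = f :=
  ⟨ModuleCat.ofHom (f.hom.codRestrict (Φ.gamma _) (hX.map_mem_gamma f.hom)), rfl⟩

variable {n : ℕ}

theorem comp_iCycles_gammaComplexι_comp_d (z : X ⟶ (Φ.gammaComplex I).cycles n) :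
    (z ≫ (Φ.gammaComplex I).iCycles n ≫ (Φ.gammaComplexι I).f n) ≫
      I.cocomplex.d n (n + 1) = 0 := by
  simp only [Category.assoc, HomologicalComplex.Hom.comm, HomologicalComplex.iCycles_d_assoc,
    zero_comp, comp_zero]

variable (X n)

/-- The class in `Ext^n(X, M)` of a morphism from `X` to the cocycles of `Γ_Φ(I)`, where `I` is an
injective resolution of `M`. -/
def gammaCocycleClass : (X ⟶ (Φ.gammaComplex I).cycles n) →ₗ[R] Abelian.Ext X M n where
  toFun z := I.extMk (z ≫ (Φ.gammaComplex I).iCycles n ≫ (Φ.gammaComplexι I).f n) (n + 1) rfl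
    (Φ.comp_iCycles_gammaComplexι_comp_d I z)
  map_add' z z' := by simp only [Preadditive.add_comp, I.add_extMk]
  map_smul' r z := by
    rw [RingHom.id_apply, ← mk₀_smul_id_comp, I.mk₀_comp_extMk]
    simp only [Linear.smul_comp, Category.id_comp]

variable {X n}

theorem gammaCocycleClass_apply (z : X ⟶ (Φ.gammaComplex I).cycles n) :
    Φ.gammaCocycleClass X I n z =
      I.extMk (z ≫ (Φ.gammaComplex I).iCycles n ≫ (Φ.gammaComplexι I).f n) (n + 1) rfl
        (Φ.comp_iCycles_gammaComplexι_comp_d I z) :=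
  rfl

theorem gammaCocycleClass_comp (g : X' ⟶ X) (z : X ⟶ (Φ.gammaComplex I).cycles n) :
    Φ.gammaCocycleClass X' I n (g ≫ z) =
      (Abelian.Ext.mk₀ g).comp (Φ.gammaCocycleClass X I n z) (zero_add n) := by
  simp only [gammaCocycleClass_apply, I.mk₀_comp_extMk, Category.assoc]

variable {Φ}

theorem gammaCocycleClass_surjective (hX : Φ.Annihilates X) :
    Function.Surjective (Φ.gammaCocycleClass X I n) := by
  intro e
  obtain ⟨f, hf, rfl⟩ := I.extMk_surjective e (n + 1) rfl
  obtain ⟨g, rfl⟩ := hX.exists_comp_gammaComplexι_f_eq I f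
  have hg : g ≫ (Φ.gammaComplex I).d n (n + 1) = 0 := by
    rw [← cancel_mono ((Φ.gammaComplexι I).f (n + 1)), Category.assoc,
      ← HomologicalComplex.Hom.comm, ← Category.assoc, hf, zero_comp]
  exact ⟨(Φ.gammaComplex I).liftCycles g (n + 1) (by simp) hg, by
    simp only [gammaCocycleClass_apply, HomologicalComplex.liftCycles_i_assoc]⟩

theorem gammaCocycleClass_eq_zero_iff (hX : Φ.Annihilates X)
    (z : X ⟶ (Φ.gammaComplex I).cycles n) :
    Φ.gammaCocycleClass X I n z = 0 ↔
      ∃ g : X ⟶ (Φ.gammaComplex I).X ((ComplexShape.up ℕ).prev n),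
        g ≫ (Φ.gammaComplex I).toCycles _ n = z := by
  rw [gammaCocycleClass_apply, extMk_injective_eq_zero_iff]
  constructor
  · rintro ⟨f, hf⟩
    obtain ⟨g, rfl⟩ := hX.exists_comp_gammaComplexι_f_eq I f
    refine ⟨g, ?_⟩
    rw [← cancel_mono ((Φ.gammaComplex I).iCycles n), ← cancel_mono ((Φ.gammaComplexι I).f n)]
    simpa only [Category.assoc, HomologicalComplex.toCycles_i, HomologicalComplex.Hom.comm]
      using hf
  · rintro ⟨g, rfl⟩
    exact ⟨g ≫ (Φ.gammaComplexι I).f _, by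
      simp only [Category.assoc, HomologicalComplex.toCycles_i_assoc,
        HomologicalComplex.Hom.comm]⟩

theorem exactAt_gammaComplex
    (h : ∀ b ∈ Φ.carrier, Subsingleton (Abelian.Ext (ModuleCat.of R (R ⧸ b)) M n)) :
    (Φ.gammaComplex I).ExactAt n := by
  refine (ShortComplex.moduleCat_exact_iff _).2 fun x hx => ?_
  obtain ⟨b, hb, hbx⟩ := x.2
  let f : ModuleCat.of R (R ⧸ b) ⟶ (Φ.gammaComplex I).X n :=
    ModuleCat.ofHom (Submodule.liftQ b (LinearMap.toSpanSingleton R _ x)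
      fun r hr => Subtype.ext (hbx r hr))
  have hf1 : f (Ideal.Quotient.mk b 1) = x := one_smul R x
  have hf : f ≫ (Φ.gammaComplex I).d n ((ComplexShape.up ℕ).next n) = 0 := by
    ext
    exact (congrArg _ hf1).trans hx
  have := h b hb
  obtain ⟨g, hg⟩ := (gammaCocycleClass_eq_zero_iff I (annihilates_quotient hb)
    ((Φ.gammaComplex I).liftCycles f _ rfl hf)).1 (Subsingleton.elim _ _)
  replace hg := congrArg (· ≫ (Φ.gammaComplex I).iCycles n) hg
  simp only [Category.assoc, HomologicalComplex.toCycles_i, HomologicalComplex.liftCycles_i] at hg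
  exact ⟨g (Ideal.Quotient.mk b 1), (ConcreteCategory.congr_hom hg _).trans hf1⟩

end GammaComplex

section ExtEquivHom

variable {R : Type u} [CommRing R] [IsNoetherianRing R] {Φ : IdealSystem R}
  {X X' M : ModuleCat.{u} R} (hX : Φ.Annihilates X) (hX' : Φ.Annihilates X') {n : ℕ}
  (hM : ∀ i < n, ∀ b ∈ Φ.carrier, Subsingleton (Abelian.Ext (ModuleCat.of R (R ⧸ b)) M i))

section

variable (I : InjectiveResolution M)

include hM

theorem rightComp_homologyπ_gammaComplex_surjective :
    Function.Surjective (Linear.rightComp R X ((Φ.gammaComplex I).homologyπ n)) := by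
  have := isSplitEpi_homologyπ fun i hi => exactAt_gammaComplex I (hM i hi)
  exact fun h => ⟨h ≫ section_ ((Φ.gammaComplex I).homologyπ n), by simp⟩

include hX in
theorem gammaCocycleClass_eq_zero_iff_rightComp_homologyπ_eq_zero
    (z : X ⟶ (Φ.gammaComplex I).cycles n) :
    Φ.gammaCocycleClass X I n z = 0 ↔
      Linear.rightComp R X ((Φ.gammaComplex I).homologyπ n) z = 0 := by
  refine (gammaCocycleClass_eq_zero_iff I hX z).trans
    ⟨?_, exists_comp_toCycles_eq (fun i hi => exactAt_gammaComplex I (hM i hi)) z⟩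
  rintro ⟨g, rfl⟩
  simp

end

/-- The module `H^n_Φ(M)` as the cohomology of `Γ_Φ(I)`. -/
def homologyIsoGeneralLocalCohomology (Φ : IdealSystem R) {M : ModuleCat.{u} R}
    (I : InjectiveResolution M) (n : ℕ) :
    (Φ.gammaComplex I).homology n ≅ (Φ.generalLocalCohomology n).obj M :=
  (I.isoRightDerivedObj Φ.gammaFunctor n).symm

/-- The isomorphism `Ext^n(X, M) ≅ Hom(X, H^n_Φ(M))` for `X` annihilated by a member of `Φ`, when
`Ext^i(R/b, M) = 0` for all `i < n` and `b ∈ Φ`. -/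
def abelianExtEquivHom :
    Abelian.Ext X M n ≃ₗ[R] (X ⟶ (Φ.generalLocalCohomology n).obj M) :=
  equivOfSurjectiveOfKer _ _ (gammaCocycleClass_surjective (injectiveResolution M) hX)
    (rightComp_homologyπ_gammaComplex_surjective hM _)
    (gammaCocycleClass_eq_zero_iff_rightComp_homologyπ_eq_zero hX hM _) ≪≫ₗ
  Linear.homCongr R (Iso.refl X) (Φ.homologyIsoGeneralLocalCohomology (injectiveResolution M) n)

theorem abelianExtEquivHom_gammaCocycleClass
    (z : X ⟶ (Φ.gammaComplex (injectiveResolution M)).cycles n) :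
    abelianExtEquivHom hX hM (Φ.gammaCocycleClass X (injectiveResolution M) n z) =
      z ≫ (Φ.gammaComplex (injectiveResolution M)).homologyπ n ≫
        (Φ.homologyIsoGeneralLocalCohomology (injectiveResolution M) n).hom := by
  rw [abelianExtEquivHom, LinearEquiv.trans_apply, equivOfSurjectiveOfKer_apply]
  simp [Linear.homCongr_apply]

theorem abelianExtEquivHom_naturality (g : X' ⟶ X) (e : Abelian.Ext X M n) :
    abelianExtEquivHom hX' hM ((Abelian.Ext.mk₀ g).comp e (zero_add n)) =
      g ≫ abelianExtEquivHom hX hM e := by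
  obtain ⟨z, rfl⟩ := gammaCocycleClass_surjective (injectiveResolution M) hX e
  rw [← gammaCocycleClass_comp, abelianExtEquivHom_gammaCocycleClass,
    abelianExtEquivHom_gammaCocycleClass, Category.assoc]

/-- The isomorphism `abelianExtEquivHom` for the derived functor `Ext` and with linear maps as
target. -/
def extEquivHom : ((Ext R (ModuleCat.{u} R) n).obj (Opposite.op X)).obj M ≃ₗ[R]
    (X →ₗ[R] (Φ.generalLocalCohomology n).obj M) :=
  extEquivAbelianExt R X M n ≪≫ₗ abelianExtEquivHom hX hM ≪≫ₗ ModuleCat.homLinearEquiv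

theorem extEquivHom_naturality (g : X' ⟶ X)
    (e : ((Ext R (ModuleCat.{u} R) n).obj (Opposite.op X)).obj M) (x : X') :
    extEquivHom hX' hM (((Ext R (ModuleCat.{u} R) n).map g.op).app M e) x =
      extEquivHom hX hM e (g x) := by
  simp only [extEquivHom, LinearEquiv.trans_apply, extEquivAbelianExt_naturality,
    abelianExtEquivHom_naturality hX hX']
  rfl

end ExtEquivHom

end IdealSystem

section Grade

variable {R : Type u} [CommRing R] (I : Ideal R) (M : Type u) [AddCommGroup M] [Module R M]
  [Module.Finite R M] {i : ℕ}

theorem subsingleton_ext_of_smul_top_eq_top (h : I • (⊤ : Submodule R M) = ⊤) :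
    Subsingleton (Abelian.Ext (ModuleCat.of R (R ⧸ I)) (ModuleCat.of R M) i) := by
  obtain ⟨r, hrI, hr⟩ := Submodule.exists_sub_one_mem_and_smul_eq_zero_of_fg_of_le_smul I
    (⊤ : Submodule R M) Module.Finite.fg_top h.ge
  refine subsingleton_ext_of_isCoprime (r := r - 1) (s := r) ⟨-1, 1, by ring⟩ ?_ ?_ i
  · ext
    exact Ideal.Quotient.eq_zero_iff_mem.2 (I.mul_mem_right _ hrI)
  · ext x
    exact hr x trivial

theorem subsingleton_ext_of_lt_idealGrade [IsNoetherianRing R] (hi : (i : ℕ∞) < idealGrade I M) :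
    Subsingleton (Abelian.Ext (ModuleCat.of R (R ⧸ I)) (ModuleCat.of R M) i) := by
  by_cases h : I • (⊤ : Submodule R M) = ⊤
  · exact subsingleton_ext_of_smul_top_eq_top I M h
  · simp only [idealGrade, if_neg h, lt_iSup_iff, Nat.cast_lt] at hi
    obtain ⟨rs, ⟨hreg, hmem⟩, hlt⟩ := hi
    refine ModuleCat.subsingleton_ext_of_exists_isRegular I (ModuleCat.of R (R ⧸ I)) ?_
      (ModuleCat.of R M) (lt_top_iff_ne_top.2 h) rs hmem hreg i hlt
    rw [Module.support_eq_zeroLocus, Ideal.annihilator_quotient]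

variable {I} in
theorem exists_pow_le_annihilator_of_support_subset (hI : I.FG)
    (h : Module.support R M ⊆ PrimeSpectrum.zeroLocus (I : Set R)) :
    ∃ k, I ^ k ≤ Module.annihilator R M := by
  rw [Module.support_eq_zeroLocus, PrimeSpectrum.zeroLocus_subset_zeroLocus_iff] at h
  exact Ideal.exists_pow_le_of_le_radical_of_fg h hI

end Grade

section GeneralizedLocalCohomology

variable {R : Type u} [CommRing R] {a : Ideal R} {N : Type u} [AddCommGroup N] [Module R N]

/-- The isomorphism `N ≅ N / I ^ m N` when `I ^ m` annihilates `N`. -/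
def isoQuotientPowersDiagramObj {m : ℕ} (h : a ^ m ≤ Module.annihilator R N) :
    ModuleCat.of R N ≅ (quotientPowersDiagram a N).obj (Opposite.op m) :=
  (Submodule.quotEquivOfEqBot _ (Submodule.le_annihilator_iff.1
    (h.trans Submodule.annihilator_top.ge))).symm.toModuleIso

theorem isIso_quotientPowersDiagram_map {k : ℕ} (h : a ^ k ≤ Module.annihilator R N)
    {m : ℕᵒᵖ} (f : m ⟶ Opposite.op k) : IsIso ((quotientPowersDiagram a N).map f) := by
  have hm : a ^ m.unop ≤ Module.annihilator R N := (Ideal.pow_le_pow_right f.unop.le).trans h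
  have : (isoQuotientPowersDiagramObj hm).hom ≫ (quotientPowersDiagram a N).map f =
      (isoQuotientPowersDiagramObj h).hom := rfl
  exact (Iso.eq_inv_comp _).2 this ▸ inferInstance

/-- `H^n_a(N, -)` is `Ext^n(N, -)` when a power of `a` annihilates `N`, as the direct system
defining it is eventually constant. -/
def generalizedLocalCohomologyIsoExt (n : ℕ) {k : ℕ} (h : a ^ k ≤ Module.annihilator R N) :
    generalizedLocalCohomology a n N ≅
      (Ext R (ModuleCat.{u} R) n).obj (Opposite.op (ModuleCat.of R N)) :=
  let F := (quotientPowersDiagram a N).op ⋙ Ext R (ModuleCat.{u} R) n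
  have hF : F.IsEventuallyConstantFrom (.op (.op k)) := fun _ f => by
    have := isIso_quotientPowersDiagram_map h f.unop
    exact inferInstanceAs (IsIso ((Ext R _ n).map ((quotientPowersDiagram a N).map f.unop).op))
  have : IsIso (colimit.ι F (.op (.op k))) := hF.isIso_ι_of_isColimit (colimit.isColimit F)
  (asIso (colimit.ι F (.op (.op k)))).symm ≪≫
    (Ext R _ n).mapIso (isoQuotientPowersDiagramObj h).op

end GeneralizedLocalCohomology

section FilteredColimit

/-- A cocone over a filtered diagram in a concrete category is colimiting if its maps are injective
and jointly surjective. -/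
def isColimitOfInjectiveOfJointlySurjective {C : Type*} [Category* C] {FC : C → C → Type*}
    {CC : C → Type w} [∀ X Y, FunLike (FC X Y) (CC X) (CC Y)] [ConcreteCategory C FC]
    {J : Type v} [Category* J] [IsFiltered J] {F : J ⥤ C} [ReflectsColimit F (forget C)]
    (c : Cocone F) (hinj : ∀ j, Function.Injective (c.ι.app j))
    (hsurj : ∀ y : ToType c.pt, ∃ j x, c.ι.app j x = y) :
    IsColimit c :=
  isColimitOfReflects (forget C) <| Types.FilteredColimit.isColimitOf' _ _
    (fun y => (hsurj y).imp fun _ => Exists.imp fun _ => Eq.symm)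
    fun i _ _ h => ⟨i, 𝟙 i, congrArg _ (hinj i h)⟩

end FilteredColimit

namespace IdealSystem

section Powers

variable {R : Type u} [CommRing R]

/-- The system of powers of an ideal. -/
def powers (a : Ideal R) : IdealSystem R where
  carrier := Set.range (a ^ · : ℕ → Ideal R)
  nonempty := Set.range_nonempty _
  exists_le_mul := by
    rintro _ ⟨m, rfl⟩ _ ⟨n, rfl⟩
    exact ⟨a ^ (m + n), ⟨m + n, rfl⟩, (pow_add a m n).le⟩

variable {Φ : IdealSystem R} {a : Ideal R} {X : Type u} [AddCommGroup X] [Module R X]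

theorem annihilates_of_pow_le_annihilator (ha : a ∈ Φ.carrier) {k : ℕ}
    (h : a ^ k ≤ Module.annihilator R X) : Φ.Annihilates X := by
  obtain ⟨K, hK, hle⟩ := exists_le_pow ha k
  exact ⟨K, hK, hle.trans h⟩

theorem annihilates_quotient_pow (ha : a ∈ Φ.carrier) (m : ℕ) :
    Φ.Annihilates (R ⧸ a ^ m) :=
  annihilates_of_pow_le_annihilator ha Ideal.annihilator_quotient.ge

theorem powers_annihilates {k : ℕ} (h : a ^ k ≤ Module.annihilator R X) :
    (powers a).Annihilates X :=
  ⟨a ^ k, ⟨k, rfl⟩, h⟩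

theorem powers_annihilates_quotient_pow (m : ℕ) : (powers a).Annihilates (R ⧸ a ^ m) :=
  powers_annihilates Ideal.annihilator_quotient.ge

/-- Linear maps from a module annihilated by a member of `Φ` take values in `Γ_Φ`. -/
def homGammaEquiv (hX : Φ.Annihilates X) (H : Type u) [AddCommGroup H] [Module R H] :
    (X →ₗ[R] Φ.gamma H) ≃ₗ[R] (X →ₗ[R] H) where
  toFun f := (Φ.gamma H).subtype ∘ₗ f
  map_add' _ _ := rfl
  map_smul' _ _ := rfl
  invFun f := LinearMap.codRestrict _ f (hX.map_mem_gamma f)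

end Powers

section LocalCohomology

variable {R : Type u} [CommRing R] [IsNoetherianRing R] {Φ : IdealSystem R} {a : Ideal R}
  (ha : a ∈ Φ.carrier) {M : ModuleCat.{u} R} {n : ℕ}
  (hM : ∀ i < n, ∀ b ∈ Φ.carrier, Subsingleton (Abelian.Ext (ModuleCat.of R (R ⧸ b)) M i))

/-- The map `Ext^n(R/a^m, M) ≅ Hom(R/a^m, H^n_Φ(M)) → Γ_a(H^n_Φ(M))`, evaluating at `1`. -/
def extQuotientPowToGamma (m : ℕ) :
    ((Ext R (ModuleCat.{u} R) n).obj (Opposite.op (ModuleCat.of R (R ⧸ a ^ m)))).obj M →ₗ[R]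
      (powers a).gamma ((Φ.generalLocalCohomology n).obj M) :=
  let φ := extEquivHom (X := ModuleCat.of R (R ⧸ a ^ m)) (annihilates_quotient_pow ha m) hM
  (LinearMap.applyₗ (Ideal.Quotient.mk (a ^ m) 1) ∘ₗ φ.toLinearMap).codRestrict _
    fun e => (powers_annihilates_quotient_pow m).map_mem_gamma (φ e) _

theorem extQuotientPowToGamma_injective (m : ℕ) :
    Function.Injective (extQuotientPowToGamma ha hM m) := by
  refine fun e e' h => (extEquivHom (X := ModuleCat.of R (R ⧸ a ^ m))
    (annihilates_quotient_pow ha m) hM).injective ?_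
  ext
  exact congrArg Subtype.val h

theorem exists_extQuotientPowToGamma_eq
    (y : (powers a).gamma ((Φ.generalLocalCohomology n).obj M)) :
    ∃ m e, extQuotientPowToGamma ha hM m e = y := by
  obtain ⟨_, ⟨m, rfl⟩, hy⟩ := y.2
  let φ := extEquivHom (X := ModuleCat.of R (R ⧸ a ^ m)) (annihilates_quotient_pow ha m) hM
  let f : (R ⧸ a ^ m) →ₗ[R] (Φ.generalLocalCohomology n).obj M :=
    Submodule.liftQ _ (LinearMap.toSpanSingleton R _ y.1) hy
  have hf : φ (φ.symm f) (Ideal.Quotient.mk (a ^ m) 1) = f (Ideal.Quotient.mk (a ^ m) 1) :=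
    LinearMap.congr_fun (φ.apply_symm_apply f) _
  exact ⟨m, φ.symm f, Subtype.ext (hf.trans (one_smul R y.1))⟩

/-- The maps `extQuotientPowToGamma`, as a cocone over the direct system defining `H^n_a(M)`. -/
def localCohomologyCocone :
    Cocone (localCohomology.diagram (localCohomology.idealPowersDiagram a) n ⋙
      (evaluation _ _).obj M) where
  pt := ModuleCat.of R ((powers a).gamma ((Φ.generalLocalCohomology n).obj M))
  ι :=
    { app := fun j => ModuleCat.ofHom (extQuotientPowToGamma ha hM j.unop.unop)
      naturality := fun i j f => by
        refine Eq.trans ?_ (Category.comp_id _).symm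
        ext e
        exact Subtype.ext (extEquivHom_naturality
          (annihilates_quotient_pow ha i.unop.unop) (annihilates_quotient_pow ha j.unop.unop) hM
          ((localCohomology.ringModIdeals (localCohomology.idealPowersDiagram a)).map f.unop) e _) }

/-- `H^n_a(M) ≅ Γ_a(H^n_Φ(M))` for `a ∈ Φ`, when `Ext^i(R/b, M) = 0` for all `i < n` and
`b ∈ Φ`. -/
def localCohomologyEquivGamma :
    (localCohomology a n).obj M ≃ₗ[R]
      (powers a).gamma ((Φ.generalLocalCohomology n).obj M) :=
  have : ReflectsFilteredColimitsOfSize.{0, 0} (forget (ModuleCat.{u} R)) :=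
    reflectsSmallestFilteredColimits_of_reflectsFilteredColimits.{u, u} _
  ((isColimitOfPreserves ((evaluation _ _).obj M) (colimit.isColimit
      (localCohomology.diagram (localCohomology.idealPowersDiagram a) n))).coconePointUniqueUpToIso
    (isColimitOfInjectiveOfJointlySurjective (localCohomologyCocone ha hM)
      (fun j => extQuotientPowToGamma_injective ha hM j.unop.unop) fun y =>
        let ⟨m, hm⟩ := exists_extQuotientPowToGamma_eq ha hM y
        ⟨.op (.op m), hm⟩)).toLinearEquiv

end LocalCohomology

end IdealSystem

theorem corollary4p9_general {R : Type u} [CommRing R] [IsNoetherianRing R] (Φ : IdealSystem R)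
    (M N : Type u) [AddCommGroup M] [Module R M] [AddCommGroup N] [Module R N]
    (a : Ideal R) (ha : a ∈ Φ.carrier) (hN : ∃ k, a ^ k ≤ Module.annihilator R N) (t : ℕ)
    (hM : ∀ i < t, ∀ b ∈ Φ.carrier,
      Subsingleton (Abelian.Ext (ModuleCat.of R (R ⧸ b)) (ModuleCat.of R M) i)) :
    Nonempty ((N →ₗ[R] (Φ.generalLocalCohomology t).obj (ModuleCat.of R M)) ≃ₗ[R]
      ((Ext R (ModuleCat.{u} R) t).obj (Opposite.op (ModuleCat.of R N))).obj
        (ModuleCat.of R M)) ∧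
    Nonempty (((Ext R (ModuleCat.{u} R) t).obj (Opposite.op (ModuleCat.of R N))).obj
        (ModuleCat.of R M) ≃ₗ[R]
      (generalizedLocalCohomology a t N).obj (ModuleCat.of R M)) ∧
    Nonempty ((generalizedLocalCohomology a t N).obj (ModuleCat.of R M) ≃ₗ[R]
      (N →ₗ[R] (localCohomology a t).obj (ModuleCat.of R M))) := by
  obtain ⟨k, hk⟩ := hN
  let e₁ := IdealSystem.extEquivHom (X := ModuleCat.of R N)
    (IdealSystem.annihilates_of_pow_le_annihilator ha hk) hM
  let e₂ := ((generalizedLocalCohomologyIsoExt t hk).app (ModuleCat.of R M)).toLinearEquiv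
  let e₃ := IdealSystem.localCohomologyEquivGamma ha hM
  refine ⟨⟨e₁.symm⟩, ⟨e₂.symm⟩, ⟨e₂ ≪≫ₗ e₁ ≪≫ₗ ?_⟩⟩
  exact (IdealSystem.homGammaEquiv (IdealSystem.powers_annihilates hk) _).symm ≪≫ₗ
    e₃.symm.congrRight

end

theorem corollary4p9 {R : Type u} [CommRing R] [IsNoetherianRing R] (Φ : IdealSystem R)
    (M N : Type u) [AddCommGroup M] [Module R M] [Module.Finite R M]
    [AddCommGroup N] [Module R N] [Module.Finite R N]
    (a : Ideal R) (ha : a ∈ Φ.carrier)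
    (hN : Module.support R N = PrimeSpectrum.zeroLocus (a : Set R))
    (t : ℕ) (ht : Φ.grade M = t) :
    Nonempty ((N →ₗ[R] (Φ.generalLocalCohomology t).obj (ModuleCat.of R M)) ≃ₗ[R]
      ((Ext R (ModuleCat.{u} R) t).obj (Opposite.op (ModuleCat.of R N))).obj
        (ModuleCat.of R M)) ∧
    Nonempty (((Ext R (ModuleCat.{u} R) t).obj (Opposite.op (ModuleCat.of R N))).obj
        (ModuleCat.of R M) ≃ₗ[R]
      (generalizedLocalCohomology a t N).obj (ModuleCat.of R M)) ∧
    Nonempty ((generalizedLocalCohomology a t N).obj (ModuleCat.of R M) ≃ₗ[R]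
      (N →ₗ[R] (localCohomology a t).obj (ModuleCat.of R M))) :=
  corollary4p9_general Φ M N a ha
    (exists_pow_le_annihilator_of_support_subset N (IsNoetherian.noetherian a) hN.subset) t
    fun _ hi b hb => subsingleton_ext_of_lt_idealGrade b M
      ((Nat.cast_lt.2 hi).trans_le (ht.ge.trans (iInf₂_le b hb)))
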